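/- Let $[n]_{p,q}=\sum_{i=0}^{n-1}p^{\,n-1-i}q^{i}=p^{n-1}+p^{n-2}q+\cdots+q^{n-1}$ (so $[0]_{p,q}=0$), and put $b_n=y[n+1]_{p,q}+[n]_{p,q}$ for $n\ge 0$ and $\lambda_n=y[n]_{p,q}^2$ for $n\ge 1$. Let $F(q,p,x,y)$ be the formal power series in $x$, with coefficients in $\mathbb{Z}[q,p,y]$, given by the continued fraction $$F(q,p,x,y)=\cfrac{1}{1-b_0x-\cfrac{\lambda_1x^2}{1-b_1x-\cfrac{\lambda_2x^2}{1-b_2x-\cfrac{\lambda_3x^2}{\ddots}}}}$$ that is, the coefficientwise limit of its finite convergents. For a permutation $\sigma$ of $[n]=\{1,\dots,n\}$, a descent is an index $i$ with $1\le i<n$ and $\sigma(i)>\sigma(i+1)$; an occurrence of the pattern $31\text{-}2$ is a pair $i<j$ of indices with $\sigma(i)>\sigma(j)>\sigma(i+1)$; an occurrence of the pattern $2\text{-}31$ is a pair $i<j$ of indices with $j+1\le n$ and $\sigma(j+1)<\sigma(i)<\sigma(j)$. Then for all integers $n,k,\ell,m\ge 0$ the coefficient of $x^n y^k q^\ell p^m$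 in $F(q,p,x,y)$ is equal to the number $D(n,k,\ell,m)$ of permutations of $[n]$ with exactly $n-k$ descents, exactly $\ell$ occurrences of $31\text{-}2$ and exactly $m$ occurrences of $2\text{-}31$. -/

import Mathlib

namespace PermPatterns

open scoped PowerSeries

/-! ### Jacobi continued fractions as formal power series -/

section ContinuedFraction

variable {R : Type*} [CommRing R]

/-- The `d`-th finite convergent, starting at level `h`, of the continued fraction
`1 / (1 - b_h x - lam_{h+1} x ^ 2 / (1 - b_{h+1} x - lam_{h+2} x ^ 2 / ...))`:
only the `d` denominators of levels `h, ..., h + d - 1` are kept. Each denominator has constant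
coefficient `1`, and `PowerSeries.invOfUnit _ 1` is its genuine inverse in `R⟦X⟧`. -/
noncomputable def jConvergent (b lam : ℕ → R) : ℕ → ℕ → R⟦X⟧
  | _, 0 => 0
  | h, d + 1 =>
    PowerSeries.invOfUnit
      (1 - PowerSeries.C (b h) * PowerSeries.X
        - PowerSeries.C (lam (h + 1)) * PowerSeries.X ^ 2 * jConvergent b lam (h + 1) d) 1

/-- The infinite continued fraction
`1 / (1 - b_0 x - lam_1 x ^ 2 / (1 - b_1 x - lam_2 x ^ 2 / ...))`, as the formal power series in
`x` that is the limit of its finite convergents: the coefficient of `x ^ n` is the same in all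
convergents of depth greater than `n` (see `coeff_jConvergent`). -/
noncomputable def jFraction (b lam : ℕ → R) : R⟦X⟧ :=
  PowerSeries.mk fun n => PowerSeries.coeff n (jConvergent b lam 0 (n + 1))

theorem jConvergent_succ_mul (b lam : ℕ → R) (h d : ℕ) :
    (1 - PowerSeries.C (b h) * PowerSeries.X
      - PowerSeries.C (lam (h + 1)) * PowerSeries.X ^ 2 * jConvergent b lam (h + 1) d)
      * jConvergent b lam h (d + 1) = 1 := by
  rw [jConvergent]
  exact PowerSeries.mul_invOfUnit _ 1 (by simp)

theorem X_pow_dvd_jConvergent_sub (b lam : ℕ → R) (d e h : ℕ) :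
    (PowerSeries.X : R⟦X⟧) ^ d ∣ jConvergent b lam h (d + e) - jConvergent b lam h d := by
  induction d generalizing h with
  | zero => simp
  | succ d ih =>
    obtain ⟨g, hg⟩ := ih (h + 1)
    have h1 := jConvergent_succ_mul b lam h d
    have h2 := jConvergent_succ_mul b lam h (d + e)
    rw [show d + 1 + e = d + e + 1 by omega]
    set A := jConvergent b lam h (d + 1)
    set B := jConvergent b lam h (d + e + 1)
    refine ⟨A * B * PowerSeries.C (lam (h + 1)) * PowerSeries.X * g, ?_⟩
    linear_combination A * h2 - B * h1 + A * B * PowerSeries.C (lam (h + 1)) * PowerSeries.X ^ 2 * hg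

/-- The convergents converge coefficientwise to `jFraction`. -/
theorem coeff_jConvergent (b lam : ℕ → R) {n d : ℕ} (hd : n < d) :
    PowerSeries.coeff n (jConvergent b lam 0 d) = PowerSeries.coeff n (jFraction b lam) := by
  obtain ⟨e, rfl⟩ := Nat.exists_eq_add_of_le (Nat.succ_le_of_lt hd)
  have h := PowerSeries.X_pow_dvd_iff.1 (X_pow_dvd_jConvergent_sub b lam (n + 1) e 0) n
    (Nat.lt_succ_self n)
  rw [map_sub, sub_eq_zero] at h
  simpa [jFraction] using h

/-- `[n]_{p,q} = p ^ (n-1) + p ^ (n-2) q + ... + p q ^ (n-2) + q ^ (n-1)`, with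
`[0]_{p,q} = 0`. -/
def pqNum (p q : R) (n : ℕ) : R := ∑ i ∈ Finset.range n, p ^ (n - 1 - i) * q ^ i

/-- The series `F(q,p,x,y)`, as a power series in `x`: the continued fraction with
`b_n = y [n+1]_{p,q} + [n]_{p,q}` and `lam_n = y [n]_{p,q} ^ 2`. -/
noncomputable def F (q p y : R) : R⟦X⟧ :=
  jFraction (fun n => y * pqNum p q (n + 1) + pqNum p q n) (fun n => y * pqNum p q n ^ 2)

end ContinuedFraction

/-! ### Permutation statistics

A permutation `σ` of `[n]` is an element of `Equiv.Perm (Fin n)`, positions and values being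
shifted by one. -/

/-- The number of descents: positions `i` with `i + 1` also a position and
`σ (i) > σ (i + 1)`. -/
def des {n : ℕ} (σ : Equiv.Perm (Fin n)) : ℕ :=
  Fintype.card {i : Fin n // ∃ h : i.val + 1 < n, σ ⟨i.val + 1, h⟩ < σ i}

/-- The number of occurrences of `31-2`: pairs of positions `i < j` with
`σ (i) > σ (j) > σ (i + 1)`. -/
def occ31_2 {n : ℕ} (σ : Equiv.Perm (Fin n)) : ℕ :=
  Fintype.card {ij : Fin n × Fin n // ij.1 < ij.2 ∧
    ∃ h : ij.1.val + 1 < n, σ ⟨ij.1.val + 1, h⟩ < σ ij.2 ∧ σ ij.2 < σ ij.1}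

/-- The number of occurrences of `2-31`: pairs of positions `i < j` with `j + 1` also a
position and `σ (j + 1) < σ (i) < σ (j)`. -/
def occ2_31 {n : ℕ} (σ : Equiv.Perm (Fin n)) : ℕ :=
  Fintype.card {ij : Fin n × Fin n // ij.1 < ij.2 ∧
    ∃ h : ij.2.val + 1 < n, σ ⟨ij.2.val + 1, h⟩ < σ ij.1 ∧ σ ij.1 < σ ij.2}

/-- The number `D(n,k,l,m)` of permutations of `[n]` with `n - k` descents, `l` occurrences of
`31-2` and `m` occurrences of `2-31`. The condition on descents is written additively, so that
no permutation is counted when `k > n`. -/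
def D (n k l m : ℕ) : ℕ :=
  Fintype.card {σ : Equiv.Perm (Fin n) //
    des σ + k = n ∧ occ31_2 σ = l ∧ occ2_31 σ = m}

/-- The three indeterminates other than `x`. -/
inductive Var
  | q
  | p
  | y
  deriving DecidableEq

end PermPatterns

namespace PermPatterns

open scoped PowerSeries

section ContinuedFraction

variable {R : Type*} [CommRing R]

/-- The tail of the continued fraction that starts at level `h`. -/
noncomputable def jTail (b lam : ℕ → R) (h : ℕ) : R⟦X⟧ :=
  PowerSeries.mk fun n => PowerSeries.coeff n (jConvergent b lam h (n + 1))

theorem X_pow_dvd_jTail_sub (b lam : ℕ → R) (d h : ℕ) :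
    (PowerSeries.X : R⟦X⟧) ^ d ∣ jTail b lam h - jConvergent b lam h d := by
  refine PowerSeries.X_pow_dvd_iff.2 fun m hm => ?_
  obtain ⟨e, rfl⟩ := Nat.exists_eq_add_of_le (Nat.succ_le_of_lt hm)
  have := PowerSeries.X_pow_dvd_iff.1 (X_pow_dvd_jConvergent_sub b lam (m + 1) e h) m
    (Nat.lt_succ_self m)
  rw [map_sub, sub_eq_zero] at this ⊢
  simp [jTail, this]

theorem jTail_mul (b lam : ℕ → R) (h : ℕ) :
    (1 - PowerSeries.C (b h) * PowerSeries.X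
      - PowerSeries.C (lam (h + 1)) * PowerSeries.X ^ 2 * jTail b lam (h + 1))
      * jTail b lam h = 1 := by
  ext n
  have key : (PowerSeries.X : R⟦X⟧) ^ (n + 1) ∣
      (1 - PowerSeries.C (b h) * PowerSeries.X
        - PowerSeries.C (lam (h + 1)) * PowerSeries.X ^ 2 * jTail b lam (h + 1))
        * jTail b lam h - 1 := by
    obtain ⟨g, hg⟩ := X_pow_dvd_jTail_sub b lam (n + 1) (h + 1)
    obtain ⟨g', hg'⟩ := X_pow_dvd_jTail_sub b lam (n + 1 + 1) h
    have h1 := jConvergent_succ_mul b lam h (n + 1)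
    refine ⟨(1 - PowerSeries.C (b h) * PowerSeries.X
      - PowerSeries.C (lam (h + 1)) * PowerSeries.X ^ 2 * jTail b lam (h + 1))
        * PowerSeries.X * g'
      - PowerSeries.C (lam (h + 1)) * PowerSeries.X ^ 2 * g
        * jConvergent b lam h (n + 1 + 1), ?_⟩
    linear_combination h1 + (1 - PowerSeries.C (b h) * PowerSeries.X
      - PowerSeries.C (lam (h + 1)) * PowerSeries.X ^ 2 * jTail b lam (h + 1)) * hg'
      - PowerSeries.C (lam (h + 1)) * PowerSeries.X ^ 2 * jConvergent b lam h (n + 1 + 1) * hg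
  have := PowerSeries.X_pow_dvd_iff.1 key n (Nat.lt_succ_self n)
  rwa [map_sub, sub_eq_zero] at this

/-- The generating function of the weighted Motzkin paths from height `h` to height `0`, where
`dn i` is the weight of a down step from height `i`. -/
noncomputable def pathSeries (b lam dn : ℕ → R) : ℕ → R⟦X⟧
  | 0 => jTail b lam 0
  | h + 1 => PowerSeries.C (dn (h + 1)) * PowerSeries.X * jTail b lam (h + 1)
      * pathSeries b lam dn h

theorem coeff_pathSeries (b lam up dn : ℕ → R) (hlam : ∀ h, lam (h + 1) = up h * dn (h + 1))
    (hdn : dn 0 = 0) (U : ℕ → ℕ → R) (hU0 : ∀ h, U 0 h = if h = 0 then 1 else 0)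
    (hU : ∀ n h, U (n + 1) h = up h * U n (h + 1) + b h * U n h + dn h * U n (h - 1))
    (n h : ℕ) : PowerSeries.coeff n (pathSeries b lam dn h) = U n h := by
  have rec0 : ∀ h, pathSeries b lam dn h = PowerSeries.C (if h = 0 then 1 else 0) +
      PowerSeries.X * (PowerSeries.C (up h) * pathSeries b lam dn (h + 1)
        + PowerSeries.C (b h) * pathSeries b lam dn h
        + PowerSeries.C (dn h) * pathSeries b lam dn (h - 1)) := by
    intro h
    have h1 := jTail_mul b lam h
    rw [hlam, map_mul] at h1
    cases h with
    | zero =>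
      simp only [pathSeries, hdn, map_zero, if_true, map_one]
      linear_combination h1
    | succ h =>
      simp only [pathSeries, Nat.add_sub_cancel, Nat.succ_ne_zero, if_false, map_zero]
      linear_combination PowerSeries.C (dn (h + 1)) * PowerSeries.X * pathSeries b lam dn h * h1
  induction n generalizing h with
  | zero => rw [rec0, hU0, map_add]; simp
  | succ n ih =>
    rw [rec0, hU, map_add, PowerSeries.coeff_succ_X_mul, PowerSeries.coeff_C]
    simp [ih]

/-- Flajolet's theorem: the coefficients of the continued fraction count weighted Motzkin
paths. -/
theorem coeff_jFraction (b lam up dn : ℕ → R) (hlam : ∀ h, lam (h + 1) = up h * dn (h + 1))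
    (hdn : dn 0 = 0) (U : ℕ → ℕ → R) (hU0 : ∀ h, U 0 h = if h = 0 then 1 else 0)
    (hU : ∀ n h, U (n + 1) h = up h * U n (h + 1) + b h * U n h + dn h * U n (h - 1))
    (n : ℕ) : PowerSeries.coeff n (jFraction b lam) = U n 0 :=
  coeff_pathSeries b lam up dn hlam hdn U hU0 hU n 0

end ContinuedFraction

/-! ### Words with separators

A word over `WithTop ℕ` in which every `x < n` occurs once records the relative positions of the
letters smaller than `n` in a permutation; each maximal run of larger letters is replaced by a
single separator `⊤`. -/

/-- The number of descents `a, b` of a word with `b < x < a`. -/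
def crossings (x : WithTop ℕ) : List (WithTop ℕ) → ℕ
  | a :: b :: t => (if b < x ∧ x < a then 1 else 0) + crossings x (b :: t)
  | _ => 0

/-- The number of ascents of a word. -/
def wordAsc : List (WithTop ℕ) → ℕ
  | a :: b :: t => (if a < b then 1 else 0) + wordAsc (b :: t)
  | _ => 0

/-- The number of occurrences of `31-2` in a word. -/
def word31_2 : List (WithTop ℕ) → ℕ
  | a :: b :: t => t.countP (fun x => b < x ∧ x < a) + word31_2 (b :: t)
  | _ => 0

/-- The number of occurrences of `2-31` in a word. -/
def word2_31 : List (WithTop ℕ) → ℕ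
  | a :: t => crossings a t + word2_31 t
  | [] => 0

/-- The words with separators at stage `n`. -/
structure IsConfig (n : ℕ) (w : List (WithTop ℕ)) : Prop where
  chain : w.IsChain (fun a b => a ≠ ⊤ ∨ b ≠ ⊤)
  last : w.getLast? = some ⊤
  count : ∀ x : ℕ, w.count (x : WithTop ℕ) = if x < n then 1 else 0

/-- All ways to write a word as `l ++ ⊤ :: r`. -/
def topSplits : List (WithTop ℕ) → List (List (WithTop ℕ) × List (WithTop ℕ))
  | [] => []
  | x :: t => (if x = ⊤ then [([], t)] else []) ++
      (topSplits t).map (fun z => (x :: z.1, z.2))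

/-- The words obtained from `l ++ ⊤ :: r` by inserting `v` at the given separator: as a new
block, at the end of the block on the left, at the beginning of the block on the right, or
joining these two blocks. -/
def insertions (v : WithTop ℕ) (z : List (WithTop ℕ) × List (WithTop ℕ)) :
    List (List (WithTop ℕ)) :=
  [z.1 ++ ⊤ :: v :: ⊤ :: z.2, z.1 ++ v :: ⊤ :: z.2] ++
    if ⊤ ∈ z.2 then [z.1 ++ ⊤ :: v :: z.2, z.1 ++ v :: z.2] else []

/-- The list of all words with separators at stage `n`. -/
def configs : ℕ → List (List (WithTop ℕ))
  | 0 => [[⊤]]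
  | n + 1 => ((configs n).flatMap topSplits).flatMap (insertions n)

theorem mem_topSplits {w : List (WithTop ℕ)} {z : List (WithTop ℕ) × List (WithTop ℕ)} :
    z ∈ topSplits w ↔ w = z.1 ++ ⊤ :: z.2 := by
  induction w generalizing z with
  | nil => simp [topSplits]
  | cons x t ih =>
    obtain ⟨l, r⟩ := z
    simp only [topSplits, List.mem_append, List.mem_map, ih]
    cases l with
    | nil => by_cases hx : x = ⊤ <;> simp [hx]; grind
    | cons a l => by_cases hx : x = ⊤ <;> simp [hx] <;> grind

theorem nodup_topSplits (w : List (WithTop ℕ)) : (topSplits w).Nodup := by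
  induction w with
  | nil => simp [topSplits]
  | cons x t ih =>
    rw [topSplits, List.nodup_append]
    refine ⟨by split <;> simp, ih.map ?_, ?_⟩
    · rintro ⟨a, b⟩ ⟨c, d⟩; simp
    · split <;> simp
      rintro a b _ _ _ rfl
      simp

theorem IsConfig.letter {n : ℕ} {w : List (WithTop ℕ)} (hw : IsConfig n w) {x : WithTop ℕ}
    (hx : x ∈ w) : x = ⊤ ∨ x < (n : WithTop ℕ) := by
  induction x using WithTop.recTopCoe with
  | top => exact Or.inl rfl
  | coe x =>
    right
    have h1 := hw.count x
    have h2 := List.count_pos_iff.2 hx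
    by_contra h
    rw [if_neg (by simpa using h)] at h1
    exact absurd h1 h2.ne'

theorem IsConfig.notMem {n : ℕ} {w : List (WithTop ℕ)} (hw : IsConfig n w) :
    (n : WithTop ℕ) ∉ w := fun h => by
  rcases hw.letter h with h | h <;> simp at h

theorem IsConfig.top_mem_iff {n : ℕ} {l r : List (WithTop ℕ)} (hw : IsConfig n (l ++ ⊤ :: r)) :
    ⊤ ∈ r ↔ r ≠ [] := by
  refine ⟨List.ne_nil_of_mem, fun h => ?_⟩
  obtain ⟨s, a, rfl⟩ := List.eq_nil_or_concat' r |>.resolve_left h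
  have := hw.last
  simp_all [List.getLast?_cons]

theorem IsConfig.insertions {n : ℕ} {z : List (WithTop ℕ) × List (WithTop ℕ)}
    (hz : IsConfig n (z.1 ++ ⊤ :: z.2)) {w : List (WithTop ℕ)} (hw : w ∈ insertions n z) :
    IsConfig (n + 1) w := by
  obtain ⟨l, r⟩ := z
  have hcount : ∀ x : ℕ, (l ++ r).count (x : WithTop ℕ) = if x < n then 1 else 0 := by
    intro x
    have := hz.count x
    simpa [List.count_append, List.count_cons] using this
  have hch := hz.chain
  have hl := hz.last
  have ht := hz.top_mem_iff
  have hcount' : ∀ x : ℕ, (l ++ r).count (x : WithTop ℕ) + (if n = x then 1 else 0)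
      = if x < n + 1 then 1 else 0 := by
    intro x
    rw [hcount]
    split_ifs <;> omega
  have htop : (n : WithTop ℕ) ≠ ⊤ := WithTop.coe_ne_top
  simp only [PermPatterns.insertions, ht] at hw
  have hw' : w = l ++ ⊤ :: (n : WithTop ℕ) :: ⊤ :: r ∨ w = l ++ (n : WithTop ℕ) :: ⊤ :: r ∨
      r ≠ [] ∧ (w = l ++ ⊤ :: (n : WithTop ℕ) :: r ∨ w = l ++ (n : WithTop ℕ) :: r) := by
    split_ifs at hw <;> simp_all
  refine ⟨?_, ?_, fun x => ?_⟩
  · rw [List.isChain_append, List.isChain_cons] at hch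
    rcases hw' with rfl | rfl | ⟨hr, rfl | rfl⟩ <;>
      simp only [List.isChain_append, List.isChain_cons, List.head?_cons] <;> simp_all
  · rcases hw' with rfl | rfl | ⟨hr, rfl | rfl⟩ <;>
      simp_all [List.getLast?_cons, List.getLast?_append]
    all_goals
      obtain ⟨s, a, rfl⟩ := List.eq_nil_or_concat' r |>.resolve_left hr
      simp_all
  · rw [← hcount' x]
    rcases hw' with rfl | rfl | ⟨hr, rfl | rfl⟩ <;>
      simp [List.count_append, List.count_cons, add_assoc]

theorem exists_mem_insertions {n : ℕ} {w : List (WithTop ℕ)} (hw : IsConfig (n + 1) w) :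
    ∃ z : List (WithTop ℕ) × List (WithTop ℕ),
      IsConfig n (z.1 ++ ⊤ :: z.2) ∧ w ∈ insertions n z := by
  have hn : (n : WithTop ℕ) ∈ w := by
    rw [← List.count_pos_iff, hw.count, if_pos (Nat.lt_succ_self n)]
    exact one_pos
  obtain ⟨l', r', rfl⟩ := List.append_of_mem hn
  have hch := hw.chain
  have hlast := hw.last
  have hcount : ∀ x : ℕ, (l' ++ r').count (x : WithTop ℕ) = if x < n then 1 else 0 := by
    intro x
    have := hw.count x
    simp only [List.count_append, List.count_cons, beq_iff_eq, Nat.cast_inj] at this ⊢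
    split_ifs at this ⊢ <;> omega
  have htop : (n : WithTop ℕ) ≠ ⊤ := WithTop.coe_ne_top
  have hr' : r' ≠ [] := by
    rintro rfl
    simp_all
  obtain ⟨l, hl, hl'⟩ : ∃ l : List (WithTop ℕ), (⊤ ∉ l.getLast?) ∧ (l' = l ∨ l' = l ++ [⊤]) := by
    rcases List.eq_nil_or_concat' l' with rfl | ⟨s, a, rfl⟩
    · exact ⟨[], by simp⟩
    · by_cases ha : a = ⊤
      · subst ha
        refine ⟨s, fun h => ?_, Or.inr rfl⟩
        rw [List.append_assoc, List.isChain_append] at hch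
        simpa using hch.2.2 _ h
      · exact ⟨s ++ [a], by simpa using ha, Or.inl rfl⟩
  obtain ⟨r, hr, hr''⟩ : ∃ r : List (WithTop ℕ), (⊤ ∉ r.head?) ∧
      ((r' = r ∧ r ≠ []) ∨ r' = ⊤ :: r) := by
    rcases r' with _ | ⟨a, s⟩
    · exact absurd rfl hr'
    · by_cases ha : a = ⊤
      · subst ha
        refine ⟨s, fun h => ?_, Or.inr rfl⟩
        rw [List.isChain_append, List.isChain_cons, List.isChain_cons] at hch
        simpa using hch.2.1.2.1 _ h
      · exact ⟨a :: s, by simpa using ha, Or.inl ⟨rfl, by simp⟩⟩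
  have hz : IsConfig n (l ++ ⊤ :: r) := by
    refine ⟨?_, ?_, fun x => ?_⟩
    · rw [List.isChain_append, List.isChain_cons] at hch ⊢
      refine ⟨?_, ⟨?_, ?_⟩, ?_⟩
      · rcases hl' with rfl | rfl
        · exact hch.1
        · exact (List.isChain_append.1 hch.1).1
      · exact fun y hy => Or.inr (by rintro rfl; exact hr hy)
      · rcases hr'' with ⟨rfl, _⟩ | rfl
        · exact hch.2.1.2
        · exact hch.2.1.2.tail
      · exact fun y hy _ _ => Or.inl (by rintro rfl; exact hl hy)
    · rcases hr'' with ⟨rfl, hne⟩ | rfl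
      · obtain ⟨s, a, rfl⟩ := List.eq_nil_or_concat' r' |>.resolve_left hne
        simp_all [List.getLast?_cons, List.getLast?_append]
      · simp_all [List.getLast?_cons, List.getLast?_append]
    · rw [← hcount x]
      rcases hl' with rfl | rfl <;> rcases hr'' with ⟨rfl, _⟩ | rfl <;>
        simp [List.count_append]
  refine ⟨(l, r), hz, ?_⟩
  have ht := hz.top_mem_iff
  rcases hl' with rfl | rfl <;> rcases hr'' with ⟨rfl, hne⟩ | rfl <;>
    simp_all [PermPatterns.insertions]

theorem isConfig_zero {w : List (WithTop ℕ)} : IsConfig 0 w ↔ w = [⊤] := by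
  constructor
  · intro h
    have hl : ∀ x ∈ w, x = ⊤ := fun x hx => (h.letter hx).resolve_right (by simp)
    have h1 := h.chain
    have h2 := h.last
    rcases w with _ | ⟨a, _ | ⟨b, t⟩⟩ <;> simp_all
  · rintro rfl
    exact ⟨by simp, by simp, by simp⟩

theorem mem_configs {n : ℕ} {w : List (WithTop ℕ)} : w ∈ configs n ↔ IsConfig n w := by
  induction n generalizing w with
  | zero => simp [configs, isConfig_zero]
  | succ n ih =>
    simp only [configs, List.mem_flatMap]
    constructor
    · rintro ⟨z, ⟨u, hu, hz⟩, hw⟩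
      rw [mem_topSplits] at hz
      subst hz
      exact (ih.1 hu).insertions hw
    · intro hw
      obtain ⟨z, hz, hw⟩ := exists_mem_insertions hw
      exact ⟨z, ⟨_, ih.2 hz, mem_topSplits.2 rfl⟩, hw⟩

theorem nodup_flatMap_of_leftInverse {α β : Type*} {s : List α} {f : α → List β} (g : β → α)
    (hs : s.Nodup) (hf : ∀ a ∈ s, (f a).Nodup) (hg : ∀ a ∈ s, ∀ b ∈ f a, g b = a) :
    (s.flatMap f).Nodup := by
  refine List.nodup_flatMap.2 ⟨hf, hs.imp_of_mem fun {a b} ha hb hab x hx hy => hab ?_⟩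
  rw [← hg a ha x hx, hg b hb x hy]

/-- The inverse of `insertions v`. -/
def uninsert (v : WithTop ℕ) (w : List (WithTop ℕ)) : List (WithTop ℕ) × List (WithTop ℕ) :=
  let l := w.takeWhile (· ≠ v)
  let r := (w.dropWhile (· ≠ v)).tail
  (if l.getLast? = some ⊤ then l.dropLast else l, if r.head? = some ⊤ then r.tail else r)

theorem uninsert_of_mem {n : ℕ} {z : List (WithTop ℕ) × List (WithTop ℕ)}
    (hz : IsConfig n (z.1 ++ ⊤ :: z.2)) {w : List (WithTop ℕ)} (hw : w ∈ insertions n z) :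
    uninsert n w = z := by
  obtain ⟨l, r⟩ := z
  have hn := hz.notMem
  simp only [List.mem_append, List.mem_cons, not_or] at hn
  have hch := hz.chain
  rw [List.isChain_append, List.isChain_cons] at hch
  have h1 : l.getLast? ≠ some ⊤ := fun h => by simpa using hch.2.2 _ h
  have h2 : r.head? ≠ some ⊤ := fun h => by simpa using hch.2.1.1 _ h
  have htop : (⊤ : WithTop ℕ) ≠ n := WithTop.coe_ne_top.symm
  have key : ∀ a b : List (WithTop ℕ), (n : WithTop ℕ) ∉ a →
      (a ++ (n : WithTop ℕ) :: b).takeWhile (· ≠ (n : WithTop ℕ)) = a ∧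
      (a ++ (n : WithTop ℕ) :: b).dropWhile (· ≠ (n : WithTop ℕ)) = (n : WithTop ℕ) :: b := by
    intro a b ha
    have : ∀ x ∈ a, decide (x ≠ (n : WithTop ℕ)) = true := by
      intro x hx
      simpa using fun h : x = n => ha (h ▸ hx)
    rw [List.takeWhile_append_of_pos this, List.dropWhile_append_of_pos this]
    simp
  have hw' : w = (l ++ [⊤]) ++ (n : WithTop ℕ) :: ⊤ :: r ∨ w = l ++ (n : WithTop ℕ) :: ⊤ :: r ∨
      w = (l ++ [⊤]) ++ (n : WithTop ℕ) :: r ∨ w = l ++ (n : WithTop ℕ) :: r := by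
    simp only [PermPatterns.insertions] at hw
    split_ifs at hw <;> simp_all
    all_goals tauto
  have hn' : (n : WithTop ℕ) ∉ l ++ [⊤] := by simp [hn.1]
  rcases hw' with rfl | rfl | rfl | rfl <;>
    simp only [uninsert, key _ _ hn.1, key _ _ hn'] <;> simp [h1, h2]

theorem nodup_insertions {n : ℕ} {z : List (WithTop ℕ) × List (WithTop ℕ)} :
    (insertions n z).Nodup := by
  have htop : (n : WithTop ℕ) ≠ ⊤ := WithTop.coe_ne_top
  unfold insertions
  split_ifs <;> simp [htop, htop.symm]

theorem nodup_configs (n : ℕ) : (configs n).Nodup := by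
  induction n with
  | zero => simp [configs]
  | succ n ih =>
    refine nodup_flatMap_of_leftInverse (uninsert n) ?_ (fun _ _ => nodup_insertions) ?_
    · refine nodup_flatMap_of_leftInverse (fun z => z.1 ++ ⊤ :: z.2) ih
        (fun _ _ => nodup_topSplits _) fun w _ z hz => ?_
      exact (mem_topSplits.1 hz).symm
    · intro z hz w hw
      obtain ⟨u, hu, hz⟩ := List.mem_flatMap.1 hz
      rw [mem_topSplits] at hz
      subst hz
      exact uninsert_of_mem (mem_configs.1 hu) hw

theorem crossings_append {x a b : WithTop ℕ} {s t : List (WithTop ℕ)} (ha : ¬ a < x)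
    (hb : ¬ b < x) (h : crossings x (a :: s) = crossings x (b :: t)) (l : List (WithTop ℕ)) :
    crossings x (l ++ a :: s) = crossings x (l ++ b :: t) := by
  induction l with
  | nil => exact h
  | cons c l ih =>
    cases l with
    | nil => simp [crossings, ha, hb, h]
    | cons d l => simpa [crossings] using ih

theorem crossings_top (l : List (WithTop ℕ)) : crossings ⊤ l = 0 := by
  induction l with
  | nil => rfl
  | cons c l ih =>
    cases l with
    | nil => rfl
    | cons d l => simpa [crossings] using ih

theorem wordAsc_append {a b : WithTop ℕ} {s t : List (WithTop ℕ)} {l : List (WithTop ℕ)}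
    (h : ∀ x ∈ l.getLast?, x < a ∧ x < b) :
    wordAsc (l ++ a :: s) + wordAsc (b :: t) = wordAsc (l ++ b :: t) + wordAsc (a :: s) := by
  induction l with
  | nil => simp [add_comm]
  | cons c l ih =>
    cases l with
    | nil =>
      have := h c (by simp)
      simp [wordAsc, this]
      omega
    | cons d l =>
      have := ih (by simpa [List.getLast?_cons] using h)
      simp only [List.cons_append, wordAsc] at this ⊢
      omega

theorem word2_31_append {a b : WithTop ℕ} {s t : List (WithTop ℕ)} {l : List (WithTop ℕ)}
    (h : ∀ x ∈ l, x ≠ ⊤ → x < a ∧ x < b ∧ crossings x (a :: s) = crossings x (b :: t)) :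
    word2_31 (l ++ a :: s) + word2_31 (b :: t) = word2_31 (l ++ b :: t) + word2_31 (a :: s) := by
  induction l with
  | nil => simp [add_comm]
  | cons c l ih =>
    have h1 := ih fun x hx => h x (by simp [hx])
    have h2 : crossings c (l ++ a :: s) = crossings c (l ++ b :: t) := by
      by_cases hc : c = ⊤
      · rw [hc, crossings_top, crossings_top]
      · obtain ⟨h3, h4, h5⟩ := h c (by simp) hc
        exact crossings_append h3.not_gt h4.not_gt h5 l
    have h3 : ∀ u, word2_31 (c :: u) = crossings c u + word2_31 u := fun _ => rfl
    rw [List.cons_append, List.cons_append, h3, h3, h2]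
    omega

theorem word31_2_append {v a b : WithTop ℕ} {s t : List (WithTop ℕ)} {l : List (WithTop ℕ)}
    (hl : ∀ x ∈ l.getLast?, x < a ∧ x < b ∧ x < v)
    (hcount : ∀ x y : WithTop ℕ, (a :: s).countP (fun z => y < z ∧ z < x)
      = (b :: t).countP (fun z => y < z ∧ z < x) + if y < v ∧ v < x then 1 else 0)
    (h : ∀ x ∈ l.getLast?, s.countP (fun z => a < z ∧ z < x) = 0 ∧
      t.countP (fun z => b < z ∧ z < x) = 0) :
    word31_2 (l ++ a :: s) + word31_2 (b :: t)
      = word31_2 (l ++ b :: t) + word31_2 (a :: s) + crossings v l := by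
  induction l with
  | nil => simp [add_comm, crossings]
  | cons c l ih =>
    cases l with
    | nil =>
      have := h c (by simp)
      simp only [Bool.decide_and] at this
      simp [word31_2, crossings, this]
      omega
    | cons d l =>
      have := ih (by simpa [List.getLast?_cons] using hl) (by simpa [List.getLast?_cons] using h)
      have h3 := hcount c d
      simp only [List.cons_append, word31_2, List.countP_append, crossings] at this ⊢
      omega

theorem crossings_add_one {v : WithTop ℕ} (hv : v ≠ ⊤) {w : List (WithTop ℕ)}
    (hch : w.IsChain (fun a b => a ≠ ⊤ ∨ b ≠ ⊤)) (hlast : w.getLast? = some ⊤)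
    (hw : ∀ x ∈ w, x = ⊤ ∨ x < v) : crossings v w + 1 = w.count ⊤ := by
  induction w with
  | nil => simp at hlast
  | cons c l ih =>
    cases l with
    | nil => simp_all [crossings]
    | cons d l =>
      rw [List.isChain_cons_cons] at hch
      have h1 := ih hch.2 (by simpa [List.getLast?_cons] using hlast)
        fun x hx => hw x (List.mem_cons_of_mem _ hx)
      have hvt := hv.lt_top
      rw [crossings, List.count_cons]
      rcases hw c (by simp) with rfl | hc
      · have hd := (hw d (by simp)).resolve_left (by simpa using hch.1)
        simp only [hd, hvt, and_self, if_true, beq_self_eq_true]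
        omega
      · have : c ≠ ⊤ := (hc.trans hvt).ne
        simp [hc.not_gt, this]
        omega

theorem IsConfig.statistics {n : ℕ} {l r : List (WithTop ℕ)} (hw : IsConfig n (l ++ ⊤ :: r)) :
    crossings n l = l.count ⊤ ∧ crossings n (⊤ :: r) = r.count ⊤ ∧
      (⊤ ∈ r → crossings n r + 1 = r.count ⊤) := by
  have hn : (n : WithTop ℕ) ≠ ⊤ := WithTop.coe_ne_top
  have hch := List.isChain_append.1 hw.chain
  have hlet : ∀ x ∈ l ++ ⊤ :: r, x = ⊤ ∨ x < (n : WithTop ℕ) := fun x hx => hw.letter hx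
  have hlast := hw.last
  refine ⟨?_, ?_, fun hr => ?_⟩
  · have h1 := crossings_add_one hn (w := l ++ [⊤])
      (List.isChain_append.2 ⟨hch.1, by simp, by simpa using hch.2.2⟩) (by simp)
      (fun x hx => hlet x (by simp at hx ⊢; tauto))
    have h2 : ∀ l : List (WithTop ℕ), crossings n (l ++ [⊤]) = crossings n l := by
      intro l
      induction l with
      | nil => rfl
      | cons c l ih =>
        cases l with
        | nil => simp [crossings]
        | cons d l => simpa [crossings] using ih
    rw [h2] at h1
    simpa using h1
  · have h1 := crossings_add_one hn (w := ⊤ :: r) hch.2.1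
      (by simpa [List.getLast?_append] using hlast)
      (fun x hx => hlet x (List.mem_append_right _ hx))
    simpa using h1
  · refine crossings_add_one hn hch.2.1.tail ?_
      (fun x hx => hlet x (List.mem_append_right _ (List.mem_cons_of_mem _ hx)))
    obtain ⟨s, a, rfl⟩ := List.eq_nil_or_concat' r |>.resolve_left (List.ne_nil_of_mem hr)
    simpa [List.getLast?_append, List.getLast?_cons] using hlast

section Insertion

variable {n : ℕ} {l r : List (WithTop ℕ)}

theorem IsConfig.lt_of_mem_getLast (hw : IsConfig n (l ++ ⊤ :: r)) :
    ∀ x ∈ l.getLast?, x < (n : WithTop ℕ) := by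
  intro x hx
  refine (hw.letter (List.mem_append_left _ (List.mem_of_mem_getLast? hx))).resolve_left ?_
  have hch := List.isChain_append.1 hw.chain
  simpa using hch.2.2 x hx ⊤

theorem IsConfig.not_lt_head (hw : IsConfig n (l ++ ⊤ :: r)) :
    ∀ x ∈ r.head?, x < (n : WithTop ℕ) := by
  intro x hx
  refine (hw.letter (List.mem_append_right _ (List.mem_cons_of_mem _
    (List.mem_of_mem_head? hx)))).resolve_left ?_
  have hch := List.isChain_cons.1 (List.isChain_append.1 hw.chain).2.1
  simpa using hch.1 x hx

theorem IsConfig.wordAsc_insert (hw : IsConfig n (l ++ ⊤ :: r)) :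
    wordAsc (l ++ ⊤ :: (n : WithTop ℕ) :: ⊤ :: r) = wordAsc (l ++ ⊤ :: r) + 1 ∧
    wordAsc (l ++ (n : WithTop ℕ) :: ⊤ :: r) = wordAsc (l ++ ⊤ :: r) + 1 ∧
    wordAsc (l ++ ⊤ :: (n : WithTop ℕ) :: r) = wordAsc (l ++ ⊤ :: r) ∧
    wordAsc (l ++ (n : WithTop ℕ) :: r) = wordAsc (l ++ ⊤ :: r) := by
  have hl := hw.lt_of_mem_getLast
  have hr := hw.not_lt_head
  have hn : (n : WithTop ℕ) < ⊤ := WithTop.coe_lt_top n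
  have hlt : ∀ x ∈ l.getLast?, x < (⊤ : WithTop ℕ) := fun x hx => (hl x hx).trans hn
  have key := fun (a : WithTop ℕ) (s : List (WithTop ℕ)) (ha : ∀ x ∈ l.getLast?, x < a) =>
    wordAsc_append (a := a) (s := s) (b := ⊤) (t := r) (l := l) fun x hx => ⟨ha x hx, hlt x hx⟩
  have h1 : wordAsc (⊤ :: r) = wordAsc r := by cases r <;> simp [wordAsc]
  have h2 : wordAsc ((n : WithTop ℕ) :: r) = wordAsc r := by
    cases r with
    | nil => simp [wordAsc]
    | cons c r => simp [wordAsc, (hr c (by simp)).not_gt]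
  have k1 := key ⊤ ((n : WithTop ℕ) :: ⊤ :: r) hlt
  have k2 := key (n : WithTop ℕ) (⊤ :: r) hl
  have k3 := key ⊤ ((n : WithTop ℕ) :: r) hlt
  have k4 := key (n : WithTop ℕ) r hl
  simp only [wordAsc, h1, h2, hn, hn.not_gt, if_true, if_false] at k1 k2 k3 k4
  omega

theorem IsConfig.word2_31_insert (hw : IsConfig n (l ++ ⊤ :: r)) :
    word2_31 (l ++ ⊤ :: (n : WithTop ℕ) :: ⊤ :: r) = word2_31 (l ++ ⊤ :: r) + r.count ⊤ ∧
    word2_31 (l ++ (n : WithTop ℕ) :: ⊤ :: r) = word2_31 (l ++ ⊤ :: r) + r.count ⊤ ∧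
    (⊤ ∈ r → word2_31 (l ++ ⊤ :: (n : WithTop ℕ) :: r) = word2_31 (l ++ ⊤ :: r) + (r.count ⊤ - 1) ∧
      word2_31 (l ++ (n : WithTop ℕ) :: r) = word2_31 (l ++ ⊤ :: r) + (r.count ⊤ - 1)) := by
  obtain ⟨-, hc1, hc2⟩ := hw.statistics
  have hn : (n : WithTop ℕ) < ⊤ := WithTop.coe_lt_top n
  have hlt : ∀ x ∈ l, x ≠ ⊤ → x < (n : WithTop ℕ) := fun x hx h =>
    (hw.letter (List.mem_append_left _ hx)).resolve_left h
  have hnr : ∀ x : WithTop ℕ, x < n → crossings x ((n : WithTop ℕ) :: r) = crossings x (⊤ :: r) := by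
    intro x hx
    cases r with
    | nil => rfl
    | cons c r => simp [crossings, hx, hx.trans hn]
  have key := fun a s ha => word2_31_append (a := a) (s := s) (b := ⊤) (t := r) (l := l) ha
  have k1 := key ⊤ ((n : WithTop ℕ) :: ⊤ :: r) fun x hx h => by
    have := hlt x hx h
    simp [crossings, this.trans hn, this.not_gt, (this.trans hn).not_gt]
  have k2 := key (n : WithTop ℕ) (⊤ :: r) fun x hx h => by
    have := hlt x hx h
    simp [crossings, this, this.trans hn, (this.trans hn).not_gt]
  have k3 := key ⊤ ((n : WithTop ℕ) :: r) fun x hx h => by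
    have := hlt x hx h
    simp [crossings, this.trans hn, this.not_gt, hnr x this]
  have k4 := key (n : WithTop ℕ) r fun x hx h => ⟨hlt x hx h, (hlt x hx h).trans hn, hnr x (hlt x hx h)⟩
  simp only [word2_31, crossings_top, hc1] at k1 k2 k3 k4
  refine ⟨by omega, by omega, fun h => ?_⟩
  have := hc2 h
  omega

theorem IsConfig.word31_2_insert (hw : IsConfig n (l ++ ⊤ :: r)) :
    word31_2 (l ++ ⊤ :: (n : WithTop ℕ) :: ⊤ :: r) = word31_2 (l ++ ⊤ :: r) + l.count ⊤ ∧
    word31_2 (l ++ (n : WithTop ℕ) :: ⊤ :: r) = word31_2 (l ++ ⊤ :: r) + l.count ⊤ ∧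
    word31_2 (l ++ ⊤ :: (n : WithTop ℕ) :: r) = word31_2 (l ++ ⊤ :: r) + l.count ⊤ ∧
    word31_2 (l ++ (n : WithTop ℕ) :: r) = word31_2 (l ++ ⊤ :: r) + l.count ⊤ := by
  obtain ⟨hc, -, -⟩ := hw.statistics
  have hl := hw.lt_of_mem_getLast
  have hn : (n : WithTop ℕ) < ⊤ := WithTop.coe_lt_top n
  have hlt : ∀ x ∈ l.getLast?, x < (⊤ : WithTop ℕ) := fun x hx => (hl x hx).trans hn
  have hz : ∀ a x : WithTop ℕ, ∀ s : List (WithTop ℕ), x < a →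
      s.countP (fun z => a < z ∧ z < x) = 0 := by
    intro a x s hx
    rw [List.countP_eq_zero]
    intro z _
    simpa using fun h => hx.le.trans h.le
  have key := fun (a : WithTop ℕ) (s : List (WithTop ℕ)) (ha : ∀ x ∈ l.getLast?, x < a) hc =>
    word31_2_append (v := n) (a := a) (s := s) (b := ⊤) (t := r) (l := l) (fun x hx => ⟨ha x hx, hlt x hx, hl x hx⟩) hc
    (fun x hx => ⟨hz _ _ _ (ha x hx), hz _ _ _ (hlt x hx)⟩)
  have k1 := key ⊤ ((n : WithTop ℕ) :: ⊤ :: r) hlt (fun x y => by simp [List.countP_cons])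
  have k2 := key (n : WithTop ℕ) (⊤ :: r) hl (fun x y => by simp [List.countP_cons])
  have k3 := key ⊤ ((n : WithTop ℕ) :: r) hlt (fun x y => by simp [List.countP_cons])
  have k4 := key (n : WithTop ℕ) r hl (fun x y => by simp [List.countP_cons])
  have h0 : ∀ s : List (WithTop ℕ), s.countP (fun z => (⊤ : WithTop ℕ) < z ∧ z < n) = 0 :=
    fun s => hz _ _ _ hn
  have hlet : ∀ z ∈ r, z = ⊤ ∨ z < (n : WithTop ℕ) := fun z hz =>
    hw.letter (List.mem_append_right _ (List.mem_cons_of_mem _ hz))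
  have h2 : word31_2 ((n : WithTop ℕ) :: ⊤ :: r) = word31_2 (⊤ :: r) := by
    rw [word31_2, h0, zero_add]
  have h3 : word31_2 ((n : WithTop ℕ) :: r) = word31_2 (⊤ :: r) := by
    cases r with
    | nil => rfl
    | cons c r =>
      rw [word31_2, word31_2]
      congr 1
      refine List.countP_congr fun z hz => ?_
      rcases hlet z (List.mem_cons_of_mem _ hz) with rfl | hz
      · simp
      · simp [hz, hz.trans hn]
  have h4 : r.countP (fun z => (n : WithTop ℕ) < z ∧ z < ⊤) = 0 := by
    rw [List.countP_eq_zero]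
    intro z hz
    rcases hlet z hz with rfl | hz
    · simp
    · simp [hz.not_gt]
  have h5 : word31_2 (⊤ :: (n : WithTop ℕ) :: ⊤ :: r) = word31_2 (⊤ :: r) := by
    rw [word31_2, h2, List.countP_cons, h4]
    simp
  have h6 : word31_2 (⊤ :: (n : WithTop ℕ) :: r) = word31_2 (⊤ :: r) := by
    rw [word31_2, h3, h4, zero_add]
  rw [h5] at k1
  rw [h2] at k2
  rw [h6] at k3
  rw [h3] at k4
  rw [hc] at k1 k2 k3 k4
  omega

end Insertion

section Weights

variable {R : Type*} [CommRing R]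

theorem pqNum_succ (p q : R) (n : ℕ) : pqNum p q (n + 1) = p ^ n + q * pqNum p q n := by
  rw [pqNum, Finset.sum_range_succ', pqNum, Finset.mul_sum, add_comm]
  simp only [pow_zero, mul_one, Nat.add_sub_cancel, Nat.sub_zero]
  congr 1
  refine Finset.sum_congr rfl fun i _ => ?_
  rw [show n - (i + 1) = n - 1 - i by omega]
  ring

/-- The weight of a word. -/
def wordWeight (q p y : R) (w : List (WithTop ℕ)) : R :=
  y ^ wordAsc w * q ^ word31_2 w * p ^ word2_31 w

/-- The operator that the insertion of a letter induces on functions of the number of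
separators. -/
def transfer (q p y : R) (f : ℕ → R) (c : ℕ) : R :=
  y * pqNum p q c * (f (c + 1) + f c) + pqNum p q (c - 1) * (f c + f (c - 1))

theorem sum_topSplits (q p : R) (w : List (WithTop ℕ)) :
    ((topSplits w).map fun z => q ^ z.1.count ⊤ * p ^ z.2.count ⊤).sum
      = pqNum p q (w.count ⊤) := by
  induction w with
  | nil => simp [topSplits, pqNum]
  | cons x t ih =>
    by_cases hx : x = ⊤
    · subst hx
      simp only [topSplits, if_true, List.map_append, List.sum_append, List.map_map,
        Function.comp_def, List.count_cons_self, pow_succ', mul_assoc, List.sum_map_mul_left, ih,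
        pqNum_succ]
      simp
    · simp only [topSplits, if_neg hx, List.map_append, List.sum_append, List.map_map,
        Function.comp_def, List.count_cons_of_ne hx, ih]
      simp

theorem sum_topSplits_of_mem (q p : R) (w : List (WithTop ℕ)) :
    ((topSplits w).map fun z =>
      if ⊤ ∈ z.2 then q ^ z.1.count ⊤ * p ^ (z.2.count ⊤ - 1) else 0).sum
      = pqNum p q (w.count ⊤ - 1) := by
  induction w with
  | nil => simp [topSplits, pqNum]
  | cons x t ih =>
    by_cases hx : x = ⊤
    · subst hx
      have : ∀ z : List (WithTop ℕ) × List (WithTop ℕ),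
          (if ⊤ ∈ z.2 then q ^ (z.1.count ⊤ + 1) * p ^ (z.2.count ⊤ - 1) else 0)
          = q * if ⊤ ∈ z.2 then q ^ z.1.count ⊤ * p ^ (z.2.count ⊤ - 1) else 0 := by
        intro z
        split_ifs <;> ring
      simp only [topSplits, if_true, List.map_append, List.sum_append, List.map_map,
        Function.comp_def, List.count_cons_self, this, List.sum_map_mul_left, ih]
      by_cases ht : ⊤ ∈ t
      · obtain ⟨c, hc⟩ := Nat.exists_eq_succ_of_ne_zero (List.count_pos_iff.2 ht).ne'
        simp [ht, hc, pqNum_succ]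
      · simp [ht, List.count_eq_zero_of_not_mem ht, pqNum]
    · simp only [topSplits, if_neg hx, List.map_append, List.sum_append, List.map_map,
        Function.comp_def, List.count_cons_of_ne hx, ih]
      simp

theorem IsConfig.sum_insertions (q p y : R) (f : ℕ → R) {n : ℕ}
    {z : List (WithTop ℕ) × List (WithTop ℕ)} (hz : IsConfig n (z.1 ++ ⊤ :: z.2)) :
    ((PermPatterns.insertions n z).map fun w => wordWeight q p y w * f (w.count ⊤)).sum
      = wordWeight q p y (z.1 ++ ⊤ :: z.2) *
        (y * (f ((z.1 ++ ⊤ :: z.2).count ⊤ + 1) + f ((z.1 ++ ⊤ :: z.2).count ⊤))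
            * (q ^ z.1.count ⊤ * p ^ z.2.count ⊤)
          + (f ((z.1 ++ ⊤ :: z.2).count ⊤) + f ((z.1 ++ ⊤ :: z.2).count ⊤ - 1))
            * if ⊤ ∈ z.2 then q ^ z.1.count ⊤ * p ^ (z.2.count ⊤ - 1) else 0) := by
  obtain ⟨l, r⟩ := z
  obtain ⟨a1, a2, a3, a4⟩ := hz.wordAsc_insert
  obtain ⟨b1, b2, b3⟩ := hz.word2_31_insert
  obtain ⟨c1, c2, c3, c4⟩ := hz.word31_2_insert
  have hn : (n : WithTop ℕ) ≠ ⊤ := WithTop.coe_ne_top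
  simp only [PermPatterns.insertions, wordWeight]
  by_cases ht : ⊤ ∈ r
  · obtain ⟨b3, b4⟩ := b3 ht
    simp only [ht, if_true, List.map_append, List.sum_append, List.map_cons, List.map_nil,
      List.sum_cons, List.sum_nil, a1, a2, a3, a4, b1, b2, b3, b4, c1, c2, c3, c4,
      List.count_append, List.count_cons_self, List.count_cons_of_ne hn, ← add_assoc,
      Nat.add_sub_cancel]
    ring
  · simp only [ht, if_false, List.map_append, List.sum_append, List.map_cons, List.map_nil,
      List.sum_cons, List.sum_nil, a1, a2, b1, b2, c1, c2,
      List.count_append, List.count_cons_self, List.count_cons_of_ne hn, ← add_assoc]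
    ring

theorem sum_map_flatMap {α β : Type*} (s : List α) (f : α → List β) (g : β → R) :
    ((s.flatMap f).map g).sum = (s.map fun a => ((f a).map g).sum).sum := by
  induction s with
  | nil => rfl
  | cons a s ih => simp [ih]

theorem sum_configs_succ (q p y : R) (f : ℕ → R) (n : ℕ) :
    ((configs (n + 1)).map fun w => wordWeight q p y w * f (w.count ⊤)).sum
      = ((configs n).map fun w => wordWeight q p y w * transfer q p y f (w.count ⊤)).sum := by
  rw [configs, sum_map_flatMap, sum_map_flatMap]
  refine congrArg List.sum (List.map_congr_left fun w hw => ?_)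
  rw [mem_configs] at hw
  have : ∀ z ∈ topSplits w,
      ((insertions n z).map fun w => wordWeight q p y w * f (w.count ⊤)).sum
      = wordWeight q p y w * (y * (f (w.count ⊤ + 1) + f (w.count ⊤))
            * (q ^ z.1.count ⊤ * p ^ z.2.count ⊤)
          + (f (w.count ⊤) + f (w.count ⊤ - 1))
            * if ⊤ ∈ z.2 then q ^ z.1.count ⊤ * p ^ (z.2.count ⊤ - 1) else 0) := by
    intro z hz
    rw [mem_topSplits] at hz
    subst hz
    exact hw.sum_insertions q p y f
  rw [List.map_congr_left this, List.sum_map_mul_left, List.sum_map_add, List.sum_map_mul_left,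
    List.sum_map_mul_left, sum_topSplits, sum_topSplits_of_mem, transfer]
  ring

theorem sum_configs (q p y : R) (f : ℕ → R) (n : ℕ) :
    ((configs n).map fun w => wordWeight q p y w * f (w.count ⊤)).sum
      = (transfer q p y)^[n] f 1 := by
  induction n generalizing f with
  | zero => simp [configs, wordWeight, wordAsc, word31_2, word2_31, crossings]
  | succ n ih => rw [sum_configs_succ, ih, Function.iterate_succ_apply]

theorem coeff_F (q p y : R) (n : ℕ) :
    PowerSeries.coeff n (F q p y)
      = ((configs n).map fun w => if w.count ⊤ = 1 then wordWeight q p y w else 0).sum := by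
  have h := sum_configs q p y (fun c => if c = 1 then 1 else 0) n
  simp only [mul_ite, mul_one, mul_zero] at h
  rw [h, F]
  refine coeff_jFraction _ _ (fun h => y * pqNum p q (h + 1)) (fun h => pqNum p q h)
    (fun h => by ring) (by simp [pqNum])
    (fun n h => (transfer q p y)^[n] (fun c => if c = 1 then 1 else 0) (h + 1))
    (fun h => by simp) (fun n h => ?_) n
  simp only [Function.iterate_succ_apply']
  rw [transfer]
  cases h with
  | zero => simp [pqNum]; ring
  | succ h => simp; ring

end Weights

section Words

theorem map_range_succ {α : Type*} (f : ℕ → α) (n : ℕ) :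
    (List.range (n + 1)).map f = f 0 :: (List.range n).map fun i => f (i + 1) := by
  rw [List.range_succ_eq_map, List.map_cons, List.map_map]
  rfl

theorem countP_map_range {α : Type*} (f : ℕ → α) (P : α → Prop) [DecidablePred P] (n : ℕ) :
    ((List.range n).map f).countP P = ∑ i ∈ Finset.range n, if P (f i) then 1 else 0 := by
  induction n generalizing f with
  | zero => simp
  | succ n ih =>
    rw [map_range_succ, List.countP_cons, ih, Finset.sum_range_succ']
    simp

theorem crossings_map_range (f : ℕ → WithTop ℕ) (x : WithTop ℕ) (n : ℕ) :
    crossings x ((List.range n).map f)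
      = ∑ i ∈ Finset.range n, if i + 1 < n ∧ f (i + 1) < x ∧ x < f i then 1 else 0 := by
  induction n generalizing f with
  | zero => rfl
  | succ n ih =>
    cases n with
    | zero => simp [crossings]
    | succ n =>
      rw [map_range_succ, map_range_succ, crossings,
        ← map_range_succ (fun i => f (i + 1)), ih, Finset.sum_range_succ' _ (n + 1), add_comm]
      simp

theorem wordAsc_map_range (f : ℕ → WithTop ℕ) (n : ℕ) :
    wordAsc ((List.range n).map f)
      = ∑ i ∈ Finset.range n, if i + 1 < n ∧ f i < f (i + 1) then 1 else 0 := by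
  induction n generalizing f with
  | zero => rfl
  | succ n ih =>
    cases n with
    | zero => simp [wordAsc]
    | succ n =>
      rw [map_range_succ, map_range_succ, wordAsc,
        ← map_range_succ (fun i => f (i + 1)), ih, Finset.sum_range_succ' _ (n + 1), add_comm]
      simp

theorem word2_31_map_range (f : ℕ → WithTop ℕ) (n : ℕ) :
    word2_31 ((List.range n).map f) = ∑ i ∈ Finset.range n, ∑ j ∈ Finset.range n,
      if i < j ∧ j + 1 < n ∧ f (j + 1) < f i ∧ f i < f j then 1 else 0 := by
  induction n generalizing f with
  | zero => rfl
  | succ n ih =>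
    rw [map_range_succ, word2_31, ih, crossings_map_range, Finset.sum_range_succ' _ n, add_comm]
    simp only [Finset.sum_range_succ' _ n]
    simp

theorem word31_2_map_range (f : ℕ → WithTop ℕ) (n : ℕ) :
    word31_2 ((List.range n).map f) = ∑ i ∈ Finset.range n, ∑ j ∈ Finset.range n,
      if i < j ∧ f (i + 1) < f j ∧ f j < f i then 1 else 0 := by
  induction n generalizing f with
  | zero => rfl
  | succ n ih =>
    cases n with
    | zero => rw [zero_add, Finset.sum_range_one, Finset.sum_range_one]; simp [word31_2]
    | succ n =>
      rw [map_range_succ, map_range_succ, word31_2, countP_map_range,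
        ← map_range_succ (fun i => f (i + 1)), ih, Finset.sum_range_succ' _ (n + 1), add_comm]
      congr 1
      · simp [Finset.sum_range_succ' _ (n + 1)]
      · simp [Finset.sum_range_succ' _ (n + 1), Finset.sum_range_succ' _ n]

variable {n : ℕ}

/-- The values of a permutation, followed by infinite values. -/
def permFun (σ : Equiv.Perm (Fin n)) (i : ℕ) : WithTop ℕ :=
  if h : i < n then ((σ ⟨i, h⟩ : ℕ) : WithTop ℕ) else ⊤

/-- The word of a permutation, followed by a separator. -/
def permWord (σ : Equiv.Perm (Fin n)) : List (WithTop ℕ) := (List.range (n + 1)).map (permFun σ)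

@[simp] theorem permFun_val (σ : Equiv.Perm (Fin n)) (i : Fin n) :
    permFun σ i = ((σ i : ℕ) : WithTop ℕ) := by simp [permFun]

@[simp] theorem permFun_self (σ : Equiv.Perm (Fin n)) : permFun σ n = ⊤ := by simp [permFun]

theorem permFun_of_lt (σ : Equiv.Perm (Fin n)) {i : ℕ} (h : i < n) :
    permFun σ i = ((σ ⟨i, h⟩ : ℕ) : WithTop ℕ) := dif_pos h

theorem permFun_of_not_lt (σ : Equiv.Perm (Fin n)) {i : ℕ} (h : ¬ i < n) :
    permFun σ i = ⊤ := dif_neg h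

theorem des_add_wordAsc (σ : Equiv.Perm (Fin n)) : des σ + wordAsc (permWord σ) = n := by
  rw [permWord, wordAsc_map_range, Finset.sum_range_succ, Finset.sum_range, des,
    Fintype.card_subtype, Finset.card_filter]
  simp only [lt_irrefl, false_and, if_false, add_zero, ← Finset.sum_add_distrib]
  rw [Finset.sum_congr rfl (g := fun _ => 1), Finset.sum_const, Finset.card_univ,
    Fintype.card_fin, smul_eq_mul, mul_one]
  intro i _
  by_cases h : (i : ℕ) + 1 < n
  · have hne : σ ⟨i + 1, h⟩ ≠ σ i := fun e => by
      have := congrArg Fin.val (σ.injective e)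
      simp at this
    rcases lt_or_gt_of_ne hne with h1 | h1
    · simp [permFun_of_lt σ h, h, h1, not_lt_of_gt h1]
    · simp [permFun_of_lt σ h, h1, not_lt_of_gt h1]
  · simp [permFun_of_not_lt σ h, h]

theorem word31_2_permWord (σ : Equiv.Perm (Fin n)) : word31_2 (permWord σ) = occ31_2 σ := by
  rw [permWord, word31_2_map_range, occ31_2, Fintype.card_subtype, Finset.card_filter,
    Fintype.sum_prod_type, Finset.sum_range_succ, Finset.sum_range]
  simp only [Finset.sum_range_succ, Finset.sum_range, permFun_val, permFun_self]
  simp only [not_top_lt, and_false, if_false, add_zero, lt_irrefl]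
  rw [Finset.sum_eq_zero (s := Finset.univ) (f := fun x : Fin n => if n < (x : ℕ) ∧ _ then 1 else 0)]
  · rw [add_zero]
    refine Finset.sum_congr rfl fun i _ => Finset.sum_congr rfl fun j _ => if_congr ?_ rfl rfl
    refine and_congr Iff.rfl ?_
    by_cases h : (i : ℕ) + 1 < n
    · simp [permFun_of_lt σ h, h]
    · simp [permFun_of_not_lt σ h, h]
  · intro x _
    simp [not_lt_of_gt x.isLt]

theorem word2_31_permWord (σ : Equiv.Perm (Fin n)) : word2_31 (permWord σ) = occ2_31 σ := by
  rw [permWord, word2_31_map_range, occ2_31, Fintype.card_subtype, Finset.card_filter,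
    Fintype.sum_prod_type, Finset.sum_range_succ, Finset.sum_range]
  simp only [Finset.sum_range_succ, Finset.sum_range, permFun_val, permFun_self]
  simp only [not_top_lt, and_false, if_false, add_zero, lt_irrefl, false_and,
    Finset.sum_const_zero]
  refine Finset.sum_congr rfl fun i _ => Finset.sum_congr rfl fun j _ => if_congr ?_ rfl rfl
  refine and_congr Iff.rfl ?_
  by_cases h : (j : ℕ) + 1 < n
  · simp [permFun_of_lt σ h, h]
  · simp [permFun_of_not_lt σ h, h]

theorem permWord_eq (σ : Equiv.Perm (Fin n)) :
    permWord σ = (List.ofFn fun i => ((σ i : ℕ) : WithTop ℕ)) ++ [⊤] := by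
  rw [permWord, List.range_succ, List.map_append, List.map_singleton, permFun_self]
  congr 1
  refine List.ext_getElem (by simp) fun i h1 h2 => ?_
  simp [permFun_of_lt σ (show i < n by simpa using h1)]

theorem permWord_injective : Function.Injective (permWord (n := n)) := by
  intro σ τ h
  rw [permWord_eq, permWord_eq, List.append_left_inj, List.ofFn_inj] at h
  ext i
  simpa using congrFun h i

theorem count_top_permWord (σ : Equiv.Perm (Fin n)) : (permWord σ).count ⊤ = 1 := by
  rw [permWord_eq, List.count_append, List.count_eq_zero_of_not_mem (by simp)]
  simp

theorem isConfig_permWord (σ : Equiv.Perm (Fin n)) : IsConfig n (permWord σ) := by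
  rw [permWord_eq]
  refine ⟨?_, by simp, fun x => ?_⟩
  · have : ∀ a ∈ List.ofFn (fun i => ((σ i : ℕ) : WithTop ℕ)), a ≠ ⊤ := by simp
    refine List.isChain_append.2 ⟨?_, by simp, ?_⟩
    · refine List.Pairwise.isChain ?_
      exact List.pairwise_iff_forall_sublist.2 fun h => Or.inl (this _ (h.subset (by simp)))
    · exact fun a ha _ _ => Or.inl (this a (List.mem_of_mem_getLast? ha))
  · have hnd : (List.ofFn fun i => ((σ i : ℕ) : WithTop ℕ)).Nodup := by
      rw [List.nodup_ofFn]
      intro i j h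
      exact σ.injective (Fin.val_injective (by simpa using h))
    rw [List.count_append, hnd.count]
    simp only [List.mem_ofFn]
    have : (∃ i, ((σ i : ℕ) : WithTop ℕ) = x) ↔ x < n := by
      constructor
      · rintro ⟨i, hi⟩
        have : (σ i : ℕ) = x := by exact_mod_cast hi
        omega
      · intro h
        exact ⟨σ.symm ⟨x, h⟩, by simp⟩
    simp only [this]
    simp

theorem exists_permWord {w : List (WithTop ℕ)} (hw : IsConfig n w) (h1 : w.count ⊤ = 1) :
    ∃ σ : Equiv.Perm (Fin n), permWord σ = w := by
  obtain ⟨s, a, rfl⟩ := (List.eq_nil_or_concat' w).resolve_left (by rintro rfl; simp at h1)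
  have hlast := hw.last
  simp only [List.getLast?_append, List.getLast?_singleton, Option.some_or,
    Option.some.injEq] at hlast
  subst hlast
  have hs : ⊤ ∉ s := by
    rw [← List.count_eq_zero]
    simpa using h1
  have hcount : ∀ x : ℕ, s.count (x : WithTop ℕ) = if x < n then 1 else 0 := by
    intro x
    simpa using hw.count x
  have hperm : s.Perm ((List.range n).map fun x => ((x : ℕ) : WithTop ℕ)) := by
    rw [List.perm_iff_count]
    intro x
    induction x using WithTop.recTopCoe with
    | top => rw [List.count_eq_zero_of_not_mem hs, List.count_eq_zero_of_not_mem (by simp)]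
    | coe x =>
      refine (hcount x).trans ?_
      refine Eq.symm ((List.count_map_of_injective (List.range n)
        (fun x : ℕ => (x : WithTop ℕ)) (fun a b h => by simpa using h) x).trans ?_)
      exact List.count_range
  have hlen : s.length = n := by simpa using hperm.length_eq
  have hnd : s.Nodup := hperm.nodup_iff.2 (List.nodup_range.map fun a b h => by simpa using h)
  have hmem : ∀ i : Fin n, ∃ x : Fin n, ((x : ℕ) : WithTop ℕ) = s[i]'(by omega) := by
    intro i
    have := hperm.mem_iff.1 (List.getElem_mem (l := s) (n := i) (by omega))
    obtain ⟨x, hx, h⟩ := List.mem_map.1 this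
    exact ⟨⟨x, by simpa using hx⟩, h⟩
  choose g hg using hmem
  have hginj : Function.Injective g := by
    intro i j h
    have := (hg i).symm.trans ((congrArg (fun x : Fin n => ((x : ℕ) : WithTop ℕ)) h).trans (hg j))
    exact Fin.val_injective ((hnd.getElem_inj_iff).1 this)
  refine ⟨Equiv.ofBijective g (Finite.injective_iff_bijective.1 hginj), ?_⟩
  rw [permWord_eq, List.append_left_inj]
  refine List.ext_getElem (by simp [hlen]) fun i h1 h2 => ?_
  simp only [List.getElem_ofFn, Equiv.ofBijective_apply]
  exact hg _

theorem sum_configs_eq_sum_perm {M : Type*} [AddCommMonoid M] (n : ℕ)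
    (g : List (WithTop ℕ) → M) :
    ((configs n).map fun w => if w.count ⊤ = 1 then g w else 0).sum
      = ∑ σ : Equiv.Perm (Fin n), g (permWord σ) := by
  rw [← List.sum_toFinset _ (nodup_configs n), ← Finset.sum_filter]
  symm
  refine Finset.sum_nbij permWord ?_ permWord_injective.injOn ?_ fun _ _ => rfl
  · intro σ _
    simp [mem_configs, isConfig_permWord, count_top_permWord]
  · intro w hw
    simp only [Finset.coe_filter, List.mem_toFinset, mem_configs, Set.mem_ofPred_eq] at hw
    obtain ⟨σ, hσ⟩ := exists_permWord hw.1 hw.2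
    exact ⟨σ, by simp, hσ⟩

/-- The coefficients of `F` are the generating polynomials of permutations by descents and
occurrences of `31-2` and `2-31`. -/
theorem coeff_F_eq_sum_perm {R : Type*} [CommRing R] (q p y : R) (n : ℕ) :
    PowerSeries.coeff n (F q p y) = ∑ σ : Equiv.Perm (Fin n),
      y ^ wordAsc (permWord σ) * q ^ occ31_2 σ * p ^ occ2_31 σ := by
  rw [coeff_F, sum_configs_eq_sum_perm]
  simp only [wordWeight, word31_2_permWord, word2_31_permWord]

end Words

end PermPatterns

theorem mainTheorem4 (n k l m : ℕ) :
    MvPolynomial.coeff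
        (Finsupp.single PermPatterns.Var.y k + Finsupp.single PermPatterns.Var.q l
          + Finsupp.single PermPatterns.Var.p m)
        (PowerSeries.coeff n
          (PermPatterns.F (R := MvPolynomial PermPatterns.Var ℤ)
            (MvPolynomial.X PermPatterns.Var.q) (MvPolynomial.X PermPatterns.Var.p)
            (MvPolynomial.X PermPatterns.Var.y)))
      = (PermPatterns.D n k l m : ℤ) := by
  rw [PermPatterns.coeff_F_eq_sum_perm, MvPolynomial.coeff_sum, PermPatterns.D,
    Fintype.card_subtype, Finset.card_filter, Nat.cast_sum]
  refine Finset.sum_congr rfl fun σ _ => ?_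
  simp only [MvPolynomial.X_pow_eq_monomial, MvPolynomial.monomial_mul, mul_one,
    MvPolynomial.coeff_monomial, Nat.cast_ite, Nat.cast_one, Nat.cast_zero]
  refine if_congr ?_ rfl rfl
  have hd := PermPatterns.des_add_wordAsc σ
  constructor
  · intro h
    have hy := DFunLike.congr_fun h PermPatterns.Var.y
    have hq := DFunLike.congr_fun h PermPatterns.Var.q
    have hp := DFunLike.congr_fun h PermPatterns.Var.p
    simp at hy hq hp
    exact ⟨by omega, hq, hp⟩
  · rintro ⟨h1, h2, h3⟩
    rw [h2, h3, show PermPatterns.wordAsc (PermPatterns.permWord σ) = k by omega]
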